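/- Let $p$ be a prime, $G$ a finite group of order $n$, $N/\mathbb{Q}_p$ a finite Galois extension containing all the $n$-th roots of unity, and let $\mathbb{Q}_p \subseteq K \subseteq M \subseteq N$ be intermediate fields with $M/K$ Galois. For a finite extension $L/\mathbb{Q}_p$ let $O_L$ denote its valuation ring, with maximal ideal $\pi_L O_L$, and suppose that $O_K/\pi_K O_K$ has $p^q$ elements. Let $F \in \mathrm{Gal}(M/K)$ be a lift of the Frobenius automorphism of the residue fields, that is, $F(x) \equiv x^{p^q} \pmod{\pi_M O_M}$ for all $x \in O_M$, and extend $F$ to the group ring by $F\bigl(\sum_\gamma \lambda_\gamma \gamma\bigr) = \sum_\gamma F(\lambda_\gamma)\gamma$. Let $R(G) = K_0(N[G])$ be the Grothendieck group of finite-dimensional representations of $G$ over $N$. For $z = \sum_\gamma \lambda_\gamma \gamma \in O_M[G]^*$ let $\mathrm{Det}(z) : R(G) \to N^*$ be the homomorphism given on a representation $T : G \to GL_u(N)$ by $\mathrm{Det}(z)(T) = \det\bigl(\sum_\gamma \lambda_\gamma T(\gamma)\bigr)$. For $m \geq 0$ let $\psi^m : R(G) \to R(G)$ be the $m$-th Adams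 operation: $\psi^m(T)$ is the virtual representation whose character is $g \mapsto \chi_T(g^m)$, where $\chi_T$ is the character of $T$. Then, for every $z \in O_M[G]^*$ and every $T \in R(G)$, \[ \frac{\mathrm{Det}(F(z))\bigl(\psi^{p^q}(T)\bigr)}{\bigl(\mathrm{Det}(z)(T)\bigr)^{p^q}} \in 1 + \pi_M O_N . \] -/

import Mathlib

namespace GroupRingDet

open scoped Matrix

noncomputable section

/-- The valuation ring of a finite extension `L` of `ℚ_p`: the integral closure of `ℤ_p` in `L`. -/
def valRing (p : ℕ) [Fact p.Prime] (L : Type*) [Field L] [Algebra ℚ_[p] L] : Subring L :=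
  (integralClosure (PadicInt.subring p) L).toSubring

/-- `π` generates the maximal ideal of the valuation ring of `L`. -/
def IsUniformizer (p : ℕ) [Fact p.Prime] (L : Type*) [Field L] [Algebra ℚ_[p] L]
    (π : valRing p L) : Prop :=
  (Ideal.span {π}).IsMaximal

/-! ### Virtual representations -/

/-- Matrix representations `T : G → GL_u(N)`, of arbitrary degree `u`. -/
abbrev MatRep (N : Type*) [Field N] (G : Type*) [Group G] : Type _ :=
  Σ u : ℕ, G →* GL (Fin u) N

/-- The relations of the Grothendieck group: isomorphic representations are identified, and
a direct sum of representations is identified with the sum of their classes. -/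
def repRelations (N : Type*) [Field N] (G : Type*) [Group G] :
    Set (FreeAbelianGroup (MatRep N G)) :=
  {x | ∃ (u : ℕ) (S T : G →* GL (Fin u) N) (P : GL (Fin u) N),
      (∀ g, T g = P * S g * P⁻¹) ∧
      x = FreeAbelianGroup.of ⟨u, T⟩ - FreeAbelianGroup.of ⟨u, S⟩} ∪
  {x | ∃ (a b : ℕ) (S : G →* GL (Fin a) N) (T : G →* GL (Fin b) N)
      (U : G →* GL (Fin (a + b)) N),
      (∀ g, (U g : Matrix (Fin (a + b)) (Fin (a + b)) N) =
        Matrix.reindex finSumFinEquiv finSumFinEquiv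
          (Matrix.fromBlocks (S g : Matrix (Fin a) (Fin a) N) 0 0
            (T g : Matrix (Fin b) (Fin b) N))) ∧
      x = FreeAbelianGroup.of ⟨a + b, U⟩ -
        (FreeAbelianGroup.of ⟨a, S⟩ + FreeAbelianGroup.of ⟨b, T⟩)}

/-- The representation group `R_N(G) = K_0(N[G])` of virtual `N`-linear representations of `G`. -/
abbrev RepGroup (N : Type*) [Field N] (G : Type*) [Group G] : Type _ :=
  FreeAbelianGroup (MatRep N G) ⧸ AddSubgroup.closure (repRelations N G)

/-- The class of a matrix representation in the representation group. -/
def RepGroup.of {N : Type*} [Field N] {G : Type*} [Group G] {u : ℕ} (T : G →* GL (Fin u) N) :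
    RepGroup N G :=
  QuotientAddGroup.mk (FreeAbelianGroup.of ⟨u, T⟩)

/-- A function on representations that is invariant under isomorphism and additive on direct
sums extends to the representation group. -/
def RepGroup.lift {N : Type*} [Field N] {G : Type*} [Group G] {A : Type*} [AddCommGroup A]
    (f : MatRep N G → A)
    (hiso : ∀ (u : ℕ) (S T : G →* GL (Fin u) N) (P : GL (Fin u) N),
      (∀ g, T g = P * S g * P⁻¹) → f ⟨u, T⟩ = f ⟨u, S⟩)
    (hsum : ∀ (a b : ℕ) (S : G →* GL (Fin a) N) (T : G →* GL (Fin b) N)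
      (U : G →* GL (Fin (a + b)) N),
      (∀ g, (U g : Matrix (Fin (a + b)) (Fin (a + b)) N) =
        Matrix.reindex finSumFinEquiv finSumFinEquiv
          (Matrix.fromBlocks (S g : Matrix (Fin a) (Fin a) N) 0 0
            (T g : Matrix (Fin b) (Fin b) N))) →
      f ⟨a + b, U⟩ = f ⟨a, S⟩ + f ⟨b, T⟩) :
    RepGroup N G →+ A :=
  QuotientAddGroup.lift _ (FreeAbelianGroup.lift f) (by
    rw [AddSubgroup.closure_le]
    rintro x (⟨u, S, T, P, h, rfl⟩ | ⟨a, b, S, T, U, h, rfl⟩)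
    · simp [AddMonoidHom.mem_ker, hiso u S T P h]
    · simp [AddMonoidHom.mem_ker, hsum a b S T U h])

/-! ### Power sums of eigenvalues as integral polynomials in characters of exterior powers -/

open Polynomial in
/-- Newton's identities: power traces of a matrix in terms of the coefficients of
`det (1 + X A)`. -/
theorem coeff_newton {N : Type*} [Field N] {ι : Type*} [Fintype ι] [DecidableEq ι]
    (A : Matrix ι ι N) (k : ℕ) :
    ((k : N) + 1) * (Matrix.det (1 + (X : N[X]) • A.map C)).coeff (k + 1) =
      ∑ x ∈ Finset.HasAntidiagonal.antidiagonal k,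
        (Matrix.det (1 + (X : N[X]) • A.map C)).coeff x.1 *
        ((-1) ^ x.2 * (A ^ (x.2 + 1)).trace) := by
  set f : N[X] := Matrix.det (1 + (X : N[X]) • A.map C) with hf
  let R := PowerSeries N
  let A' : Matrix ι ι R := A.map (PowerSeries.C (R := N))
  let S : Matrix ι ι R := Matrix.of fun i j => PowerSeries.mk fun k => ((-A) ^ k) i j
  have hS : (1 + (PowerSeries.X : R) • A') * S = 1 := by
    ext i j k
    rw [add_mul, one_mul, Matrix.smul_mul, Matrix.add_apply, Matrix.smul_apply, smul_eq_mul,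
      map_add]
    cases k with
    | zero =>
      simp only [S, Matrix.of_apply, PowerSeries.coeff_mk, pow_zero,
        PowerSeries.coeff_zero_X_mul, add_zero, Matrix.one_apply]
      split_ifs <;> simp
    | succ k =>
      rw [PowerSeries.coeff_succ_X_mul, Matrix.mul_apply, map_sum]
      have h0 : ∀ x, PowerSeries.coeff k (A' i x * S x j) = A i x * ((-A) ^ k) x j := by
        intro x
        rw [show A' i x = PowerSeries.C (A i x) from rfl, PowerSeries.coeff_C_mul]
        simp [S]
      have : (-A) ^ (k+1) = -(A * (-A)^k) := by rw [pow_succ', neg_mul]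
      have h1 : PowerSeries.coeff (k + 1) (S i j) = ((-A) ^ (k + 1)) i j := by simp [S]
      rw [Finset.sum_congr rfl fun x _ => h0 x, h1]
      rw [this, Matrix.neg_apply, Matrix.mul_apply, Matrix.one_apply]
      split_ifs <;> simp [PowerSeries.coeff_one]
  have key : ((derivative f : N[X]) : R) = (f : R) * (S * A').trace := by
    let D := DualNumber R
    let a : D := algebraMap R D PowerSeries.X + DualNumber.eps
    have heps : (DualNumber.eps : D) ^ 2 = 0 := by rw [sq, DualNumber.eps_mul_eps]
    have hcoe : ∀ g : N[X], aeval (algebraMap R D PowerSeries.X) g = algebraMap R D (g : R) := by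
      intro g
      rw [aeval_algebraMap_apply]
      congr 1
      have : (aeval (PowerSeries.X : R)) = Polynomial.coeToPowerSeries.algHom (R := N) N := by
        apply Polynomial.algHom_ext
        simp [Polynomial.coeToPowerSeries.algHom_apply]
      rw [this, Polynomial.coeToPowerSeries.algHom_apply]
      simp
    have h1 : ((1 : Matrix ι ι D) + a • A'.map (algebraMap R D)) =
        (1 + (PowerSeries.X : R) • A').map (algebraMap R D) *
          (1 + (DualNumber.eps : D) • (S * A').map (algebraMap R D)) := by
      rw [mul_add, mul_one, Matrix.mul_smul, ← Matrix.map_mul, ← mul_assoc, hS, one_mul]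
      ext i j : 1
      simp only [Matrix.add_apply, Matrix.smul_apply, Matrix.map_apply, smul_eq_mul, a, map_add,
        map_mul, Matrix.one_apply]
      split_ifs <;> simp <;> ring
    have h2 := congrArg Matrix.det h1
    have h3 : ∀ (B : Matrix ι ι R), (B.map (algebraMap R D)).det = algebraMap R D B.det :=
      fun B => ((algebraMap R D).map_det B).symm
    have h4 : Matrix.det (1 + (PowerSeries.X : R) • A') = (f : R) := by
      have := (Polynomial.coeToPowerSeries.ringHom (R := N)).map_det
        (1 + (X : N[X]) • A.map C)
      rw [← hf] at this
      simp only [Polynomial.coeToPowerSeries.ringHom_apply] at this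
      rw [this]
      congr 1
      ext i j : 1
      simp only [Matrix.add_apply, Matrix.smul_apply, RingHom.mapMatrix_apply, Matrix.map_apply,
        smul_eq_mul, map_add, map_mul, A', Matrix.one_apply]
      split_ifs <;> simp [Polynomial.coeToPowerSeries.ringHom_apply]
    have h5 : Matrix.det ((1 : Matrix ι ι D) + a • A'.map (algebraMap R D)) = aeval a f := by
      rw [hf, AlgHom.map_det]
      congr 1
      ext i j : 1
      simp only [Matrix.add_apply, Matrix.smul_apply, AlgHom.mapMatrix_apply, Matrix.map_apply,
        smul_eq_mul, map_add, map_mul, A', Matrix.one_apply, aeval_X, aeval_C]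
      split_ifs <;> simp <;> rfl
    rw [h5, Matrix.det_mul, h3, h4, Matrix.det_one_add_smul, heps, mul_zero, add_zero,
      aeval_add_of_sq_eq_zero _ _ _ heps, hcoe, hcoe] at h2
    have h6 : Matrix.trace ((S * A').map (algebraMap R D)) = algebraMap R D (S * A').trace :=
      (AddMonoidHom.map_trace (algebraMap R D) (S * A')).symm
    rw [h6] at h2
    have h7 := congrArg TrivSqZeroExt.snd h2
    have h8 : ∀ r : R, algebraMap R D r = TrivSqZeroExt.inl r := fun r => rfl
    have h9 : ∀ r s : R, TrivSqZeroExt.snd ((TrivSqZeroExt.inl r : DualNumber R) *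
        (1 + TrivSqZeroExt.inl s * DualNumber.eps)) = r * s := fun r s => by
      simp [TrivSqZeroExt.snd_mul]
    simp only [h8] at h7
    rw [h9] at h7
    simpa using h7
  have h8 := congrArg (PowerSeries.coeff k) key
  rw [Polynomial.coeff_coe, coeff_derivative, PowerSeries.coeff_mul] at h8
  rw [mul_comm, h8]
  refine Finset.sum_congr rfl fun x _ => ?_
  rw [Polynomial.coeff_coe, Matrix.trace_mul_comm]
  congr 1
  have h9 : (-1 : N) ^ x.2 • A ^ (x.2 + 1) = A * (-A) ^ x.2 := by
    rw [show -A = (-1 : N) • A by simp, _root_.smul_pow, Matrix.mul_smul, pow_succ']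
  rw [← smul_eq_mul ((-1 : N) ^ x.2), ← Matrix.trace_smul, h9, Matrix.trace, map_sum, Matrix.trace]
  refine Finset.sum_congr rfl fun i _ => ?_
  rw [Matrix.diag_apply, Matrix.mul_apply, map_sum, Matrix.diag_apply, Matrix.mul_apply]
  refine Finset.sum_congr rfl fun j _ => ?_
  rw [show A' i j = PowerSeries.C (A i j) from rfl, PowerSeries.coeff_C_mul]
  simp [S]

open Polynomial in
/-- The trace of the `k`-th exterior power of `A` is the `k`-th coefficient of `det (1 + X A)`. -/
theorem trace_exteriorPower_map {N : Type*} [Field N] {u : ℕ} (A : Matrix (Fin u) (Fin u) N)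
    (k : ℕ) :
    LinearMap.trace N _ (exteriorPower.map k (Matrix.toLin' A)) =
      (Matrix.det (1 + (X : N[X]) • A.map C)).coeff k := by
  rw [Matrix.coeff_det_one_add_X_smul_eq_sum_minors]
  rw [LinearMap.trace_eq_matrix_trace N ((Pi.basisFun N (Fin u)).exteriorPower k), Matrix.trace]
  have h : ∀ s : Set.powersetCard (Fin u) k,
      (LinearMap.toMatrix ((Pi.basisFun N (Fin u)).exteriorPower k)
        ((Pi.basisFun N (Fin u)).exteriorPower k)
        (exteriorPower.map k (Matrix.toLin' A))).diag s =
      (A.submatrix (Subtype.val : s.1 → Fin u) (Subtype.val : s.1 → Fin u)).det := by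
    intro s
    rw [Matrix.diag_apply, LinearMap.toMatrix_apply, exteriorPower.basis_apply,
      exteriorPower.map_apply_ιMulti_family, exteriorPower.basis_repr_apply,
      exteriorPower.ιMulti_family, exteriorPower.ιMultiDual_apply_ιMulti]
    rw [← Matrix.det_submatrix_equiv_self (s.1.orderIsoOfFin s.2).toEquiv, ← Matrix.det_transpose]
    congr 1
    ext i j
    simp [Set.powersetCard.ofFinEmbEquiv_symm_apply]
    rfl
  rw [Finset.sum_congr rfl fun s _ => h s]
  symm
  apply Finset.sum_subtype (p := fun s => s ∈ Set.powersetCard (Fin u) k) (f := fun s => (A.submatrix (Subtype.val : s → Fin u) (Subtype.val : s → Fin u)).det)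
  intro s
  simp [Set.powersetCard]

/-! ### Characters and Adams operations -/

section Adams
variable {N : Type*} [Field N] {G : Type*} [Group G]

/-- The character of a virtual representation. -/
def RepGroup.character : RepGroup N G →+ (G → N) :=
  RepGroup.lift (fun T g => (T.2 g : Matrix (Fin T.1) (Fin T.1) N).trace)
    (by
      intro u S T P h
      funext g
      simp only [h g, Units.val_mul]
      rw [Matrix.trace_mul_comm, ← mul_assoc, ← Units.val_mul, inv_mul_cancel, Units.val_one,
        one_mul])
    (by
      intro a b S T U h
      funext g
      simp only [h g, Pi.add_apply]
      rw [Matrix.trace, ← Equiv.sum_comp finSumFinEquiv]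
      simp [Matrix.trace])

theorem RepGroup.character_of {u : ℕ} (T : G →* GL (Fin u) N) (g : G) :
    RepGroup.character (RepGroup.of T) g = (T g : Matrix (Fin u) (Fin u) N).trace := by
  simp [RepGroup.character, RepGroup.lift, RepGroup.of]

theorem exists_character_eq_trace {ι : Type*} [Fintype ι] [DecidableEq ι]
    (ρ : G →* Matrix ι ι N) :
    ∃ S : RepGroup N G, ∀ g, RepGroup.character S g = (ρ g).trace := by
  let e := Fintype.equivFin ι
  let φ : Matrix ι ι N →* Matrix (Fin (Fintype.card ι)) (Fin (Fintype.card ι)) N :=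
    (Matrix.reindexAlgEquiv N N e).toAlgHom.toMonoidHom
  refine ⟨RepGroup.of (MonoidHom.toHomUnits (φ.comp ρ)), fun g => ?_⟩
  rw [RepGroup.character_of, Matrix.trace, Matrix.trace, ← Equiv.sum_comp e]
  simp [φ]

/-- Products of virtual characters are virtual characters. -/
theorem exists_character_mul (S T : RepGroup N G) :
    ∃ R : RepGroup N G, ∀ g,
      RepGroup.character R g = RepGroup.character S g * RepGroup.character T g := by
  induction S using QuotientAddGroup.induction_on with
  | H S =>
  induction T using QuotientAddGroup.induction_on with
  | H T =>
  induction S using FreeAbelianGroup.induction_on with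
  | zero => exact ⟨0, fun g => by simp⟩
  | of S =>
    induction T using FreeAbelianGroup.induction_on with
    | zero => exact ⟨0, fun g => by simp⟩
    | of T =>
      obtain ⟨R, hR⟩ := exists_character_eq_trace (N := N) (G := G)
        { toFun := fun g => Matrix.kronecker (S.2 g : Matrix (Fin S.1) (Fin S.1) N)
            (T.2 g : Matrix (Fin T.1) (Fin T.1) N)
          map_one' := by simp
          map_mul' := fun g h => by simp [Matrix.mul_kronecker_mul] }
      refine ⟨R, fun g => ?_⟩
      rw [hR]
      erw [RepGroup.character_of, RepGroup.character_of]
      exact Matrix.trace_kronecker _ _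
    | neg T h =>
      obtain ⟨R, hR⟩ := h
      exact ⟨-R, fun g => by simp [hR]⟩
    | add T T' h h' =>
      obtain ⟨R, hR⟩ := h
      obtain ⟨R', hR'⟩ := h'
      exact ⟨R + R', fun g => by simp [hR, hR', mul_add]⟩
  | neg T h =>
    obtain ⟨R, hR⟩ := h
    exact ⟨-R, fun g => by simp [hR]⟩
  | add T T' h h' =>
    obtain ⟨R, hR⟩ := h
    obtain ⟨R', hR'⟩ := h'
    exact ⟨R + R', fun g => by simp [hR, hR', add_mul]⟩

open Polynomial in
/-- The coefficients of `det (1 + X T(g))` are characters, namely those of exterior powers. -/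
theorem exists_character_coeff {u : ℕ} (T : G →* GL (Fin u) N) (k : ℕ) :
    ∃ S : RepGroup N G, ∀ g, RepGroup.character S g =
      (Matrix.det (1 + (X : N[X]) • (T g : Matrix (Fin u) (Fin u) N).map C)).coeff k := by
  let b := (Pi.basisFun N (Fin u)).exteriorPower k
  let ρ : G →* Module.End N (⋀[N]^k (Fin u → N)) :=
    { toFun := fun g => exteriorPower.map k (Matrix.toLin' (T g : Matrix (Fin u) (Fin u) N))
      map_one' := by
        rw [map_one, Units.val_one, Matrix.toLin'_one, exteriorPower.map_id]
        rfl
      map_mul' := fun g h => by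
        rw [map_mul, Units.val_mul, Matrix.toLin'_mul, exteriorPower.map_comp]
        rfl }
  obtain ⟨S, hS⟩ := exists_character_eq_trace (N := N) (G := G)
    ((LinearMap.toMatrixAlgEquiv b).toAlgHom.toMonoidHom.comp ρ)
  refine ⟨S, fun g => ?_⟩
  rw [hS, ← trace_exteriorPower_map, LinearMap.trace_eq_matrix_trace N b]
  rfl

theorem exists_character_pow_of {u : ℕ} (T : G →* GL (Fin u) N) (m : ℕ) :
    ∃ S : RepGroup N G, ∀ g, RepGroup.character S g =
      (((T g : Matrix (Fin u) (Fin u) N)) ^ m).trace := by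
  induction m using Nat.strong_induction_on with
  | _ m ih =>
  cases m with
  | zero =>
    exact exists_character_eq_trace (N := N) (G := G)
      ⟨⟨fun g => (T g : Matrix (Fin u) (Fin u) N) ^ 0, by simp⟩, by simp⟩
  | succ k =>
    choose E hE using exists_character_coeff T
    have ih' : ∀ j : ℕ, ∃ S : RepGroup N G, j < k → ∀ g, RepGroup.character S g =
        (((T g : Matrix (Fin u) (Fin u) N)) ^ (j + 1)).trace := fun j => by
      by_cases hj : j < k
      · obtain ⟨S, hS⟩ := ih (j + 1) (by omega)
        exact ⟨S, fun _ => hS⟩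
      · exact ⟨0, fun h => absurd h hj⟩
    choose P hP using ih'
    choose Q hQ using exists_character_mul (N := N) (G := G)
    refine ⟨(-1 : ℤ) ^ k • (((k : ℤ) + 1) • E (k + 1) -
      ∑ i ∈ Finset.range k, (-1 : ℤ) ^ (k - (i + 1)) • Q (E (i + 1)) (P (k - (i + 1)))), fun g => ?_⟩
    have h := coeff_newton (T g : Matrix (Fin u) (Fin u) N) k
    rw [Finset.Nat.sum_antidiagonal_eq_sum_range_succ_mk, Finset.sum_range_succ'] at h
    have h0 : (Matrix.det (1 + (Polynomial.X : Polynomial N) •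
        (T g : Matrix (Fin u) (Fin u) N).map Polynomial.C)).coeff 0 = 1 := by
      rw [Polynomial.coeff_zero_eq_eval_zero, _root_.eval_det_add_X_smul]
      simp
    rw [h0, one_mul, Nat.sub_zero] at h
    have h1 : ∑ i ∈ Finset.range k, (-1 : N) ^ (k - (i + 1)) *
        RepGroup.character (Q (E (i + 1)) (P (k - (i + 1)))) g =
        ∑ i ∈ Finset.range k, (Matrix.det (1 + (Polynomial.X : Polynomial N) •
        (T g : Matrix (Fin u) (Fin u) N).map Polynomial.C)).coeff (i + 1) *
          ((-1) ^ (k - (i + 1)) *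
            ((T g : Matrix (Fin u) (Fin u) N) ^ (k - (i + 1) + 1)).trace) := by
      refine Finset.sum_congr rfl fun i hi => ?_
      rw [hQ, hE, hP _ (by have := Finset.mem_range.mp hi; omega)]
      ring
    simp only [map_zsmul, map_sub, map_sum, Pi.smul_apply, Pi.sub_apply, Finset.sum_apply]
    simp only [zsmul_eq_mul, Int.cast_pow, Int.cast_neg, Int.cast_one, Int.cast_add, Int.cast_natCast]
    rw [h1, hE, h, add_sub_cancel_left, ← mul_assoc, ← mul_pow]
    simp

/-- For every virtual representation `T` there is a virtual representation with character
`g ↦ χ_T(g ^ m)`. -/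
theorem exists_adams (m : ℕ) (T : RepGroup N G) :
    ∃ S : RepGroup N G, ∀ g, RepGroup.character S g = RepGroup.character T (g ^ m) := by
  induction T using QuotientAddGroup.induction_on with
  | H T =>
  induction T using FreeAbelianGroup.induction_on with
  | zero => exact ⟨0, fun g => by simp⟩
  | of T =>
    obtain ⟨S, hS⟩ := exists_character_pow_of T.2 m
    refine ⟨S, fun g => ?_⟩
    erw [RepGroup.character_of]
    rw [hS, map_pow, Units.val_pow_eq_pow_val]
  | neg T h =>
    obtain ⟨R, hR⟩ := h
    exact ⟨-R, fun g => by simp [hR]⟩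
  | add T T' h h' =>
    obtain ⟨R, hR⟩ := h
    obtain ⟨R', hR'⟩ := h'
    exact ⟨R + R', fun g => by simp [hR, hR']⟩

/-- The `m`-th Adams operation on the representation group: `ψ^m(T)` is the virtual
representation with character `g ↦ χ_T(g ^ m)`. (Over a field of characteristic zero a virtual
representation is determined by its character.) -/
def adams (m : ℕ) (T : RepGroup N G) : RepGroup N G :=
  (exists_adams m T).choose

theorem character_adams (m : ℕ) (T : RepGroup N G) (g : G) :
    RepGroup.character (adams m T) g = RepGroup.character T (g ^ m) :=
  (exists_adams m T).choose_spec g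

end Adams

/-! ### Determinants -/

section Det

variable {p : ℕ} [Fact p.Prime] {M N : Type*} [Field M] [Field N] [Algebra ℚ_[p] M]
  [Algebra M N] {G : Type*} [Group G]

/-- The extension of a representation `T : G → GL_u(N)` to the group ring `O_M[G]`,
`∑ λ_γ γ ↦ ∑ λ_γ T(γ)`. -/
def evalRep {u : ℕ} (T : G →* GL (Fin u) N) :
    MonoidAlgebra (valRing p M) G →ₐ[valRing p M] Matrix (Fin u) (Fin u) N :=
  MonoidAlgebra.lift (valRing p M) (Matrix (Fin u) (Fin u) N) G ((Units.coeHom _).comp T)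

theorem evalRep_single {u : ℕ} (T : G →* GL (Fin u) N) (g : G) (c : valRing p M) :
    evalRep T (MonoidAlgebra.single g c) =
      algebraMap M N (c : M) • (T g : Matrix (Fin u) (Fin u) N) := by
  rw [evalRep, MonoidAlgebra.lift_single]
  ext i j
  rw [Matrix.smul_apply, Matrix.smul_apply, smul_eq_mul, ← Algebra.smul_def]
  rfl

/-- `Det(z)(T) = det (∑ λ_γ T(γ))` for a unit `z = ∑ λ_γ γ` of `O_M[G]` and a
representation `T`. -/
def detRep (z : (MonoidAlgebra (valRing p M) G)ˣ) (T : MatRep N G) : Nˣ :=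
  Units.map Matrix.detMonoidHom (Units.map (evalRep T.2).toMonoidHom z)

theorem coe_detRep (z : (MonoidAlgebra (valRing p M) G)ˣ) (T : MatRep N G) :
    (detRep z T : N) = (evalRep T.2 (z : MonoidAlgebra (valRing p M) G)).det := rfl

/-- The homomorphism `Det(z)` on virtual representations, with values in `N^*`. -/
def detHom (z : (MonoidAlgebra (valRing p M) G)ˣ) : RepGroup N G →+ Additive Nˣ :=
  RepGroup.lift (fun T => Additive.ofMul (detRep z T))
    (by
      intro u S T P h
      congr 1
      ext
      rw [coe_detRep, coe_detRep]
      have key : ∀ x : MonoidAlgebra (valRing p M) G, evalRep T x =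
          (P : Matrix (Fin u) (Fin u) N) * evalRep S x * (P⁻¹ : GL (Fin u) N) := by
        intro x
        induction x using MonoidAlgebra.induction_linear with
        | zero => simp
        | add x y hx hy => simp only [map_add, hx, hy, mul_add, add_mul]
        | single g c => simp only [evalRep_single, h g, Units.val_mul, Matrix.mul_smul,
            Matrix.smul_mul]
      rw [key, Matrix.det_mul_right_comm, ← Units.val_mul, mul_inv_cancel, Units.val_one, one_mul])
    (by
      intro a b S T U h
      rw [← ofMul_mul]
      congr 1
      ext
      rw [Units.val_mul, coe_detRep, coe_detRep, coe_detRep]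
      have key : ∀ x : MonoidAlgebra (valRing p M) G, evalRep U x =
          Matrix.reindex finSumFinEquiv finSumFinEquiv
            (Matrix.fromBlocks (evalRep S x) 0 0 (evalRep T x)) := by
        intro x
        induction x using MonoidAlgebra.induction_linear with
        | zero => simp
        | add x y hx hy =>
          rw [map_add, hx, hy, map_add, map_add]
          have hb := (Matrix.fromBlocks_add (evalRep S x) 0 0 (evalRep T x)
            (evalRep S y) 0 0 (evalRep T y)).symm
          rw [add_zero, add_zero] at hb
          rw [hb]
          rfl
        | single g c =>
          rw [evalRep_single, h g, evalRep_single, evalRep_single]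
          have hb := (Matrix.fromBlocks_smul (algebraMap M N (c : M))
            (S g : Matrix (Fin a) (Fin a) N) 0 0 (T g : Matrix (Fin b) (Fin b) N)).symm
          rw [smul_zero, smul_zero] at hb
          rw [hb]
          rfl
      rw [key, Matrix.det_reindex_self, Matrix.det_fromBlocks_zero₂₁])

/-- `Det(z)(T)` for a unit `z` of `O_M[G]` and a virtual representation `T`. -/
def Det (z : (MonoidAlgebra (valRing p M) G)ˣ) (T : RepGroup N G) : Nˣ :=
  (detHom z T).toMul

theorem Det_of (z : (MonoidAlgebra (valRing p M) G)ˣ) {u : ℕ} (T : G →* GL (Fin u) N) :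
    (Det z (RepGroup.of T) : N) = (evalRep T (z : MonoidAlgebra (valRing p M) G)).det := by
  simp [Det, detHom, RepGroup.lift, RepGroup.of, coe_detRep]

end Det

/-! ### The Frobenius lift -/

section Frobenius

variable {p : ℕ} [Fact p.Prime] {K M : Type*} [Field K] [Field M] [Algebra ℚ_[p] K]
  [Algebra ℚ_[p] M] [Algebra K M] [IsScalarTower ℚ_[p] K M]

/-- An automorphism `F` of `M` over `K` preserves the valuation ring of `M`. -/
def valRingMap (F : M ≃ₐ[K] M) : valRing p M →+* valRing p M :=
  (F : M →+* M).restrict (valRing p M) (valRing p M) fun _ hx =>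
    IsIntegral.map ((F.toAlgHom.restrictScalars ℚ_[p]).restrictScalars (PadicInt.subring p)) hx

/-- `F ∈ Gal(M/K)` is a lift of the Frobenius automorphism of the residue field extension:
`F(x) ≡ x^s` modulo `π_M O_M` for all `x ∈ O_M`, where `s` is the number of elements of the
residue field of `K`. -/
def IsFrobeniusLift (π : valRing p M) (s : ℕ) (F : M ≃ₐ[K] M) : Prop :=
  ∀ x : valRing p M, valRingMap F x - x ^ s ∈ Ideal.span {π}

/-- The automorphism `∑ λ_γ γ ↦ ∑ F(λ_γ) γ` of the group ring `O_M[G]`, on its units. -/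
def frobUnits {G : Type*} [Group G] (F : M ≃ₐ[K] M) :
    (MonoidAlgebra (valRing p M) G)ˣ →* (MonoidAlgebra (valRing p M) G)ˣ :=
  Units.map (MonoidAlgebra.mapRingHom G (valRingMap F)).toMonoidHom

theorem frobUnits_apply {G : Type*} [Group G] (F : M ≃ₐ[K] M)
    (z : (MonoidAlgebra (valRing p M) G)ˣ) (g : G) :
    (((frobUnits F z : MonoidAlgebra (valRing p M) G).coeff g : valRing p M) : M) =
      F ((z : MonoidAlgebra (valRing p M) G).coeff g : M) := by
  change (((MonoidAlgebra.mapRingHom G (valRingMap F) z.val).coeff g : valRing p M) : M) = _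
  rw [MonoidAlgebra.coeff_mapRingHom]
  rfl

end Frobenius

end
end GroupRingDet

open GroupRingDet

/-! Write `s = p ^ q`. For a single term, `det (1 + c T(g) X ^ k)` is the product of the `1 + c x X
^ k` over the eigenvalues `x` of `T(g)`. These are roots of unity, hence integral. Applying `F` to
`c` and `ψ^s` to `T` gives the product of the `1 + F(c) x ^ s X ^ k`. Since `F(c) ≡ c ^ s` and `p ≡
0` modulo `π_M`, substituting `X ^ s` for `X` turns this into the `s`-th power of the first product
(`map_expand_prod_eq_pow`).

This polynomial congruence is multiplicative in the argument and closed under X-adic approximation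
(`PowCongruence.mul`, `PowCongruence.of_approx`). Products of the elements `1 + c g X ^ k`
approximate every polynomial over the group ring with constant term `1`
(`exists_elementary_approx`). So the congruence holds for `1 + (z - 1) X`. It is then an identity
between genuine polynomials, so `X = 1` may be substituted: this recovers `z`, and `X ^ s` also
becomes `1`.

Virtual representations are written as differences and the congruence is cross-multiplied. That `S₁
- S₂` is `ψ^s(T₁ - T₂)` enters only through characters: in characteristic zero, Newton's identities
recover `det (1 + X A)` from the traces of powers. The determinants divided by at the end are units,
because those of `z⁻¹` are integral as well. -/

namespace GroupRingDet

open Polynomial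

/-! ### Traces of powers, eigenvalues and `det (1 + X A)`. -/

section Matrices

variable {N : Type*} [Field N] {ι κ : Type*} [Fintype ι] [DecidableEq ι] [Fintype κ]
  [DecidableEq κ]

/-- The polynomial `det (1 + X A)`. -/
noncomputable def detOneAdd (A : Matrix ι ι N) : N[X] :=
  Matrix.det (1 + (X : N[X]) • A.map C)

theorem coeff_zero_detOneAdd (A : Matrix ι ι N) : (detOneAdd A).coeff 0 = 1 := by
  rw [detOneAdd, coeff_zero_eq_eval_zero, eval_det_add_X_smul]
  simp

theorem detOneAdd_eq_charpolyRev_comp (A : Matrix ι ι N) :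
    detOneAdd A = A.charpolyRev.comp (-X) := by
  have h : A.charpolyRev.comp (-X) = compRingHom (-X) A.charpolyRev := rfl
  rw [h, Matrix.charpolyRev, detOneAdd, RingHom.map_det]
  congr 1
  ext i j : 1
  by_cases hij : i = j <;> simp [hij]

/-- Both polynomials are the reversed characteristic polynomial evaluated at `-X`. -/
theorem detOneAdd_eq_of_charpoly_eq {A : Matrix ι ι N} {B : Matrix κ κ N}
    (h : A.charpoly = B.charpoly) : detOneAdd A = detOneAdd B := by
  rw [detOneAdd_eq_charpolyRev_comp, detOneAdd_eq_charpolyRev_comp, ← Matrix.reverse_charpoly,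
    ← Matrix.reverse_charpoly, h]

theorem detOneAdd_diagonal (d : ι → N) :
    detOneAdd (Matrix.diagonal d) = ∏ i, (1 + C (d i) * X) := by
  have h : (1 + (X : N[X]) • (Matrix.diagonal d).map C) =
      Matrix.diagonal fun i => 1 + C (d i) * X := by
    ext i j : 1
    by_cases hij : i = j <;> simp [hij, X_mul_C]
  rw [detOneAdd, h, Matrix.det_diagonal]

theorem detOneAdd_fromBlocks (A : Matrix ι ι N) (B : Matrix κ κ N) :
    detOneAdd (Matrix.fromBlocks A 0 0 B) = detOneAdd A * detOneAdd B := by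
  have h : (1 + (X : N[X]) • (Matrix.fromBlocks A 0 0 B).map C) =
      Matrix.fromBlocks (1 + (X : N[X]) • A.map C) 0 0 (1 + (X : N[X]) • B.map C) := by
    rw [← Matrix.fromBlocks_one, Matrix.fromBlocks_map, Matrix.fromBlocks_smul,
      Matrix.fromBlocks_add]
    simp
  rw [detOneAdd, h, Matrix.det_fromBlocks_zero₂₁]
  rfl

theorem trace_fromBlocks_pow (A : Matrix ι ι N) (B : Matrix κ κ N) (k : ℕ) :
    (Matrix.fromBlocks A 0 0 B ^ k).trace = (A ^ k).trace + (B ^ k).trace := by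
  rw [Matrix.fromBlocks_diagonal_pow]
  simp [Matrix.trace]

/-- In characteristic zero, the traces of the powers of `A` determine `det (1 + X A)`. -/
theorem detOneAdd_eq_of_trace_pow_eq [CharZero N] {A : Matrix ι ι N} {B : Matrix κ κ N}
    (h : ∀ k, (A ^ k).trace = (B ^ k).trace) : detOneAdd A = detOneAdd B := by
  ext k
  induction k using Nat.strong_induction_on with
  | _ k ih =>
  cases k with
  | zero => rw [coeff_zero_detOneAdd, coeff_zero_detOneAdd]
  | succ k =>
    have hk : ((k : N) + 1) ≠ 0 := Nat.cast_add_one_ne_zero k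
    apply mul_left_cancel₀ hk
    refine (coeff_newton A k).trans (Eq.trans ?_ (coeff_newton B k).symm)
    refine Finset.sum_congr rfl fun x hx => ?_
    have hx' := Finset.HasAntidiagonal.mem_antidiagonal.mp hx
    rw [h]
    congr 1
    exact ih x.1 (by omega)

/-- `det (1 + X A)` determines the traces of the powers of `A`. -/
theorem trace_pow_succ_eq_of_detOneAdd_eq {A : Matrix ι ι N} {B : Matrix κ κ N}
    (h : detOneAdd A = detOneAdd B) (k : ℕ) :
    (A ^ (k + 1)).trace = (B ^ (k + 1)).trace := by
  induction k using Nat.strong_induction_on with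
  | _ k ih =>
  have hA := coeff_newton A k
  have hB := coeff_newton B k
  rw [← detOneAdd] at hA hB
  rw [h, hB, Finset.Nat.sum_antidiagonal_eq_sum_range_succ_mk,
    Finset.Nat.sum_antidiagonal_eq_sum_range_succ_mk, Finset.sum_range_succ',
    Finset.sum_range_succ'] at hA
  -- Every term of Newton's identity except the one with coefficient index `0` involves only lower
  -- powers, which agree by induction. Since that coefficient is `1`, the remaining term isolates
  -- the trace of the power `k + 1`.
  have h0 : ∀ i ∈ Finset.range k,
      (detOneAdd B).coeff (i + 1) * ((-1) ^ (k - (i + 1)) * (B ^ (k - (i + 1) + 1)).trace) =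
      (detOneAdd B).coeff (i + 1) * ((-1) ^ (k - (i + 1)) * (A ^ (k - (i + 1) + 1)).trace) :=
    fun i hi => by rw [ih (k - (i + 1)) (by have := Finset.mem_range.mp hi; omega)]
  rw [Finset.sum_congr rfl h0] at hA
  have h1 := (add_left_cancel hA).symm
  rw [coeff_zero_detOneAdd, one_mul, one_mul] at h1
  simpa using h1

/-- A matrix of finite order over a field with enough roots of unity: `det (1 + X A ^ s)` is the
product of the `1 + x ^ s X` over the eigenvalues `x` of `A`. -/
theorem exists_detOneAdd_pow_eq_prod [CharZero N] {A : Matrix ι ι N} {n : ℕ} (hn : 0 < n)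
    (hA : A ^ n = 1) {ζ : N} (hζ : IsPrimitiveRoot ζ n) :
    ∃ m : Multiset N, (∀ x ∈ m, x ^ n = 1) ∧
      ∀ s, 0 < s → detOneAdd (A ^ s) = (m.map fun x => 1 + C (x ^ s) * X).prod := by
  have hroots : ∀ {L : Type _} [Field L] (B : Matrix ι ι L), B ^ n = 1 →
      ∀ x ∈ B.charpoly.roots, x ^ n = 1 := by
    intro L _ B hB x hx
    have h1 := Matrix.mem_spectrum_of_isRoot_charpoly ((mem_roots B.charpoly_monic.ne_zero).mp hx)
    have h2 := spectrum.pow_mem_pow B n h1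
    rw [hB] at h2
    have : Nontrivial (Matrix ι ι L) := by
      by_contra hne
      rw [not_nontrivial_iff_subsingleton] at hne
      rw [spectrum.of_subsingleton] at h1
      exact h1
    rw [spectrum.one_eq] at h2
    exact h2
  -- Over an algebraic closure every eigenvalue is an `n`-th root of unity, hence a power of `ζ`,
  -- and so already lies in `N`.
  have hsplit : A.charpoly.Splits := by
    refine Splits.of_splits_map (algebraMap N (AlgebraicClosure N)) (IsAlgClosed.splits _) ?_
    intro x hx
    rw [← Matrix.charpoly_map] at hx
    have hx1 := hroots (A.map (algebraMap N (AlgebraicClosure N)))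
      (by
        have := map_pow (algebraMap N (AlgebraicClosure N)).mapMatrix A n
        rw [hA, map_one] at this
        exact this.symm) x hx
    have : NeZero n := ⟨hn.ne'⟩
    obtain ⟨i, -, hi⟩ := (hζ.map_of_injective
      (algebraMap N (AlgebraicClosure N)).injective).eq_pow_of_pow_eq_one hx1
    exact ⟨ζ ^ i, by rw [map_pow, hi]⟩
  classical
  refine ⟨A.charpoly.roots, hroots A hA, fun s hs => ?_⟩
  set m := A.charpoly.roots with hm
  -- Comparing `A` with the diagonal matrix of its eigenvalues by characteristic polynomials avoids
  -- diagonalizing `A`.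
  have hchar : A.charpoly = (Matrix.diagonal fun x : m.ToType => x.1).charpoly := by
    rw [Matrix.charpoly_diagonal, hsplit.eq_prod_roots_of_monic A.charpoly_monic, ← hm,
      Finset.prod_eq_multiset_prod, Multiset.map_univ m (fun x => X - C x)]
  have htr := trace_pow_succ_eq_of_detOneAdd_eq (detOneAdd_eq_of_charpoly_eq hchar)
  have hpow : ∀ k, ((A ^ s) ^ k).trace =
      (((Matrix.diagonal fun x : m.ToType => x.1) ^ s) ^ k).trace := by
    intro k
    -- Newton's identities say nothing about exponent `0`; there the trace is the size of the
    -- matrix, read off from the degree of the characteristic polynomial.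
    cases k with
    | zero =>
      have h1 := congrArg natDegree hchar
      rw [Matrix.charpoly_natDegree_eq_dim, Matrix.charpoly_natDegree_eq_dim] at h1
      simp [Matrix.trace_one, h1]
    | succ k =>
      rw [← pow_mul, ← pow_mul]
      obtain ⟨j, hj⟩ : ∃ j, s * (k + 1) = j + 1 :=
        Nat.exists_eq_succ_of_ne_zero (Nat.mul_ne_zero hs.ne' k.succ_ne_zero)
      rw [hj, htr]
  rw [detOneAdd_eq_of_trace_pow_eq hpow, Matrix.diagonal_pow, detOneAdd_diagonal,
    Finset.prod_eq_multiset_prod]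
  exact congrArg Multiset.prod (Multiset.map_univ m (fun x => 1 + C (x ^ s) * X))

end Matrices

end GroupRingDet

namespace GroupRingDet

open Polynomial

/-! ### Determinants of polynomials over a noncommutative ring. -/

section PolyDet

variable {A : Type*} [Ring A] {N : Type*} [Field N] {ι : Type*} [Fintype ι] [DecidableEq ι]

/-- The determinant `A[X] → N[X]` attached to a matrix representation `A → Mat(N)`. -/
noncomputable def polyDet (ρ : A →+* Matrix ι ι N) : A[X] →* N[X] :=
  Matrix.detMonoidHom.comp (RingHom.polyToMatrix ρ).toMonoidHom

theorem polyDet_apply (ρ : A →+* Matrix ι ι N) (u : A[X]) :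
    polyDet ρ u = (RingHom.polyToMatrix ρ u).det := rfl

theorem polyToMatrix_C (ρ : A →+* Matrix ι ι N) (a : A) :
    RingHom.polyToMatrix ρ (C a) = (ρ a).map C := by
  change matPolyEquiv.symm ((C a).map ρ) = _
  rw [map_C, matPolyEquiv_symm_C]

theorem polyToMatrix_X (ρ : A →+* Matrix ι ι N) :
    RingHom.polyToMatrix ρ X = (X : N[X]) • (1 : Matrix ι ι N[X]) := by
  change matPolyEquiv.symm (X.map ρ) = _
  rw [map_X, matPolyEquiv_symm_X, Matrix.smul_one_eq_diagonal]

theorem polyToMatrix_one_add (ρ : A →+* Matrix ι ι N) (a : A) (k : ℕ) :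
    RingHom.polyToMatrix ρ (1 + C a * X ^ k) = 1 + (X : N[X]) ^ k • (ρ a).map C := by
  rw [map_add, map_one, map_mul, map_pow, polyToMatrix_C, polyToMatrix_X, _root_.smul_pow, one_pow,
    Matrix.mul_smul, mul_one]

/-- Substituting `c X ^ k` for `X` is a ring homomorphism, so it commutes with the determinant. -/
theorem polyDet_one_add (ρ : A →+* Matrix ι ι N) (a : A) (k : ℕ) {c : N} {B : Matrix ι ι N}
    (h : ρ a = c • B) :
    polyDet ρ (1 + C a * X ^ k) = (detOneAdd B).comp (C c * X ^ k) := by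
  have h1 : (detOneAdd B).comp (C c * X ^ k) = compRingHom (C c * X ^ k) (detOneAdd B) := rfl
  rw [polyDet_apply, polyToMatrix_one_add, h1, detOneAdd, RingHom.map_det, h]
  congr 1
  ext i j : 1
  by_cases hij : i = j <;> simp [hij] <;> ring

theorem eval_one_polyDet (ρ : A →+* Matrix ι ι N) (a : A) :
    (polyDet ρ (1 + C a * X)).eval 1 = (ρ (1 + a)).det := by
  have h := polyToMatrix_one_add ρ a 1
  rw [pow_one, pow_one] at h
  rw [polyDet_apply, h, ← coe_evalRingHom, RingHom.map_det, map_add, map_one]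
  congr 1
  ext i j : 1
  by_cases hij : i = j <;> simp [hij]

/-- The determinant can be computed over `N[X]/(X ^ L)`, which makes it X-adically continuous. -/
theorem polyDet_congr (ρ : A →+* Matrix ι ι N) {u v : A[X]} {L : ℕ}
    (h : ∀ k < L, u.coeff k = v.coeff k) {k : ℕ} (hk : k < L) :
    (polyDet ρ u).coeff k = (polyDet ρ v).coeff k := by
  have hdvd : (X : N[X]) ^ L ∣ polyDet ρ u - polyDet ρ v := by
    rw [← Ideal.mem_span_singleton, ← Ideal.Quotient.mk_eq_mk_iff_sub_mem, polyDet_apply,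
      polyDet_apply, RingHom.map_det, RingHom.map_det]
    congr 1
    ext i j : 1
    rw [RingHom.mapMatrix_apply, RingHom.mapMatrix_apply, Matrix.map_apply, Matrix.map_apply,
      Ideal.Quotient.mk_eq_mk_iff_sub_mem, Ideal.mem_span_singleton, X_pow_dvd_iff]
    intro d hd
    have hc : ∀ w : A[X], (RingHom.polyToMatrix ρ w i j).coeff d = ρ (w.coeff d) i j := by
      intro w
      change (matPolyEquiv.symm (w.map ρ) i j).coeff d = _
      rw [matPolyEquiv_symm_apply_coeff, coeff_map]
    rw [coeff_sub, hc, hc, h d hd, sub_self]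
  have := X_pow_dvd_iff.mp hdvd k hk
  rwa [coeff_sub, sub_eq_zero] at this

end PolyDet

/-! ### Approximation by products of elements `1 + c g X ^ k`. -/

section Generators

variable {A₀ : Type*} [CommRing A₀] {G : Type*} [Group G]

/-- The submonoid of `A₀[G][X]` generated by the elements `1 + c g X ^ k` with `k > 0`. -/
noncomputable def elementarySubmonoid (A₀ : Type*) [CommRing A₀] (G : Type*) [Group G] :
    Submonoid (MonoidAlgebra A₀ G)[X] :=
  Submonoid.closure {u | ∃ (g : G) (c : A₀) (k : ℕ), 0 < k ∧
    u = 1 + C (MonoidAlgebra.single g c) * X ^ k}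

theorem X_pow_dvd_mul_sub_mul {A : Type*} [Ring A] {L : ℕ} {u u' v v' : A[X]}
    (h : X ^ L ∣ u - v) (h' : X ^ L ∣ u' - v') : X ^ L ∣ u * u' - v * v' := by
  obtain ⟨r, hr⟩ := h
  obtain ⟨r', hr'⟩ := h'
  refine ⟨r * u' + v * r', ?_⟩
  have h1 : u * u' - v * v' = (u - v) * u' + v * (u' - v') := by
    rw [sub_mul, mul_sub]; abel
  rw [h1, hr, hr', mul_add, ← mul_assoc, ← mul_assoc, ← mul_assoc, X_pow_mul (p := v)]

/-- Modulo `X ^ (L + 1)`, the map `y ↦ 1 + y X ^ L` turns sums into products: the cross term has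
degree `2 L ≥ L + 1`, as `L > 0`. -/
theorem exists_elementary_one_add (y : MonoidAlgebra A₀ G) {L : ℕ} (hL : 0 < L) :
    ∃ w ∈ elementarySubmonoid A₀ G, X ^ (L + 1) ∣ (1 + C y * X ^ L) - w := by
  induction y using MonoidAlgebra.induction_linear with
  | zero => exact ⟨1, one_mem _, by simp⟩
  | add x y hx hy =>
    obtain ⟨v, hv, hv'⟩ := hx
    obtain ⟨w, hw, hw'⟩ := hy
    refine ⟨v * w, mul_mem hv hw, ?_⟩
    have h1 := X_pow_dvd_mul_sub_mul hv' hw'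
    have h2 : (X : (MonoidAlgebra A₀ G)[X]) ^ (L + 1) ∣ C x * X ^ L * (C y * X ^ L) := by
      refine ⟨C x * C y * X ^ (L - 1), ?_⟩
      rw [X_pow_mul (n := L + 1), mul_assoc (C x), ← mul_assoc (X ^ L), X_pow_mul (n := L),
        mul_assoc (C y), ← pow_add, mul_assoc, ← pow_add, mul_assoc,
        show L - 1 + (L + 1) = L + L by omega]
    have h3 : (1 + C (x + y) * X ^ L) - v * w =
        ((1 + C x * X ^ L) * (1 + C y * X ^ L) - v * w) - C x * X ^ L * (C y * X ^ L) := by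
      rw [map_add]; noncomm_ring
    rw [h3]
    exact dvd_sub h1 h2
  | single g c => exact ⟨_, Submonoid.subset_closure ⟨g, c, L, hL, rfl⟩, by simp⟩

theorem coeff_zero_of_mem_elementarySubmonoid {v : (MonoidAlgebra A₀ G)[X]}
    (hv : v ∈ elementarySubmonoid A₀ G) : v.coeff 0 = 1 := by
  induction hv using Submonoid.closure_induction with
  | mem x hx =>
    obtain ⟨g, c, k, hk, rfl⟩ := hx
    simp [coeff_X_pow, hk.ne]
  | one => simp
  | mul x y _ _ hx hy => rw [mul_coeff_zero, hx, hy, one_mul]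

/-- Every polynomial over the group ring with constant coefficient `1` is approximated by
products of elements `1 + c g X ^ k`. -/
theorem exists_elementary_approx {u : (MonoidAlgebra A₀ G)[X]} (hu : u.coeff 0 = 1) (L : ℕ) :
    ∃ v ∈ elementarySubmonoid A₀ G, X ^ (L + 1) ∣ u - v := by
  induction L with
  | zero => exact ⟨1, one_mem _, by simp [X_dvd_iff, hu]⟩
  | succ L ih =>
    obtain ⟨v, hv, r, hr⟩ := ih
    -- The factor `w` cancels the lowest coefficient of the error `X ^ (L + 1) * r`; multiplying by
    -- `v` does not change that coefficient, as `v` has constant term `1`.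
    obtain ⟨w, hw, hw'⟩ := exists_elementary_one_add (r.coeff 0) L.succ_pos
    refine ⟨v * w, mul_mem hv hw, ?_⟩
    have hv0 := coeff_zero_of_mem_elementarySubmonoid hv
    have h1 := X_pow_dvd_mul_sub_mul (u := v) (v := v) (L := L + 1 + 1) (by simp) hw'
    have h2 : X ^ (L + 1 + 1) ∣ X ^ (L + 1) * (r - v * C (r.coeff 0)) := by
      obtain ⟨t, ht⟩ := X_dvd_iff.mpr (show (r - v * C (r.coeff 0)).coeff 0 = 0 by
        rw [coeff_sub, mul_coeff_zero, hv0, coeff_C_zero, one_mul, sub_self])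
      exact ⟨t, by rw [ht, ← mul_assoc, ← pow_succ]⟩
    have h3 : u - v * w = X ^ (L + 1) * (r - v * C (r.coeff 0)) +
        (v * (1 + C (r.coeff 0) * X ^ (L + 1)) - v * w) := by
      rw [mul_sub, ← hr, X_pow_mul, mul_add, mul_one, mul_assoc]
      abel
    rw [h3]
    exact dvd_add h2 h1

end Generators

end GroupRingDet

namespace GroupRingDet

open Polynomial

/-! ### The congruence for polynomial determinants. -/

section FrobeniusCongruence

variable {R : Type*} [CommRing R]

/-- If `p ∈ I` and `e ≡ c ^ s` modulo `I` with `s = p ^ q`, then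
`∏ (1 + x ^ s e X ^ (s k)) ≡ (∏ (1 + x c X ^ k)) ^ s` modulo `I`. -/
theorem map_expand_prod_eq_pow {p : ℕ} (hp : p.Prime) (q : ℕ) {I : Ideal R} (hpI : (p : R) ∈ I)
    {c e : R} (hce : e - c ^ p ^ q ∈ I) (k : ℕ) (m : Multiset R) :
    (expand R (p ^ q) (((m.map fun x => 1 + C (x ^ p ^ q) * X).prod).comp (C e * X ^ k))).map
        (Ideal.Quotient.mk I) =
      (((m.map fun x => 1 + C (x ^ 1) * X).prod.comp (C c * X ^ k)) ^ p ^ q).map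
        (Ideal.Quotient.mk I) := by
  induction m using Multiset.induction_on with
  | empty => simp
  | cons x m ih =>
    have hp0 : ((p : ℕ) : (R ⧸ I)[X]) = 0 := by
      rw [← C_eq_natCast, ← map_natCast (Ideal.Quotient.mk I), Ideal.Quotient.eq_zero_iff_mem.mpr hpI,
        C_0]
    have he : Ideal.Quotient.mk I e = Ideal.Quotient.mk I c ^ p ^ q := by
      rw [← map_pow, Ideal.Quotient.mk_eq_mk_iff_sub_mem]
      exact hce
    -- The mixed terms of `(1 + x c X ^ k) ^ s` carry a factor `p`, which vanishes modulo `I`.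
    obtain ⟨r, hr⟩ := exists_add_pow_prime_pow_eq hp (1 : (R ⧸ I)[X])
      (C (Ideal.Quotient.mk I x) * (C (Ideal.Quotient.mk I c) * X ^ k)) q
    rw [hp0, zero_mul, zero_mul, zero_mul, add_zero, one_pow] at hr
    rw [Multiset.map_cons, Multiset.map_cons, Multiset.prod_cons, Multiset.prod_cons, mul_comp,
      mul_comp, map_mul, Polynomial.map_mul, mul_pow, Polynomial.map_mul, ih]
    congr 1
    simp only [add_comp, one_comp, pow_comp, mul_comp, C_comp, X_comp, map_add, map_one, map_mul, expand_C,
      map_pow, expand_X, Polynomial.map_add, Polynomial.map_one, Polynomial.map_mul, map_C,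
      Polynomial.map_pow, map_X, he, pow_one]
    rw [hr, mul_pow, mul_pow, ← pow_mul, ← pow_mul, mul_comm k]

variable {N : Type*} [Field N] {A : Type*} [Ring A] {ι₁ ι₂ κ₁ κ₂ : Type*}
  [Fintype ι₁] [DecidableEq ι₁] [Fintype ι₂] [DecidableEq ι₂]
  [Fintype κ₁] [DecidableEq κ₁] [Fintype κ₂] [DecidableEq κ₂]

/-- The determinants of `u` under `ρ₁`, `ρ₂`, `σ₁`, `σ₂` are integral, and modulo `I` the virtual
determinant of `u` under `ρ₁ - ρ₂`, evaluated at `X ^ s`, is the `s`-th power of the one under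
`σ₁ - σ₂`. -/
def PowCongruence (f : R →+* N) (I : Ideal R) (s : ℕ) (ρ₁ : A →+* Matrix ι₁ ι₁ N)
    (ρ₂ : A →+* Matrix ι₂ ι₂ N) (σ₁ : A →+* Matrix κ₁ κ₁ N) (σ₂ : A →+* Matrix κ₂ κ₂ N)
    (u : A[X]) : Prop :=
  ∃ a₁ a₂ b₁ b₂ : R[X], polyDet ρ₁ u = a₁.map f ∧ polyDet ρ₂ u = a₂.map f ∧
    polyDet σ₁ u = b₁.map f ∧ polyDet σ₂ u = b₂.map f ∧
    (expand R s a₁ * b₂ ^ s).map (Ideal.Quotient.mk I) =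
      (expand R s a₂ * b₁ ^ s).map (Ideal.Quotient.mk I)

variable {f : R →+* N} {I : Ideal R} {s : ℕ} {ρ₁ : A →+* Matrix ι₁ ι₁ N}
  {ρ₂ : A →+* Matrix ι₂ ι₂ N} {σ₁ : A →+* Matrix κ₁ κ₁ N} {σ₂ : A →+* Matrix κ₂ κ₂ N}

theorem PowCongruence.one : PowCongruence f I s ρ₁ ρ₂ σ₁ σ₂ 1 :=
  ⟨1, 1, 1, 1, by simp, by simp, by simp, by simp, rfl⟩

theorem PowCongruence.mul {u v : A[X]} (hu : PowCongruence f I s ρ₁ ρ₂ σ₁ σ₂ u)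
    (hv : PowCongruence f I s ρ₁ ρ₂ σ₁ σ₂ v) : PowCongruence f I s ρ₁ ρ₂ σ₁ σ₂ (u * v) := by
  obtain ⟨a₁, a₂, b₁, b₂, h1, h2, h3, h4, h⟩ := hu
  obtain ⟨a₁', a₂', b₁', b₂', h1', h2', h3', h4', h'⟩ := hv
  refine ⟨a₁ * a₁', a₂ * a₂', b₁ * b₁', b₂ * b₂', by rw [map_mul, h1, h1', Polynomial.map_mul],
    by rw [map_mul, h2, h2', Polynomial.map_mul], by rw [map_mul, h3, h3', Polynomial.map_mul],
    by rw [map_mul, h4, h4', Polynomial.map_mul], ?_⟩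
  rw [map_mul, map_mul, mul_pow, mul_pow, mul_mul_mul_comm, Polynomial.map_mul, h, h',
    ← Polynomial.map_mul, mul_mul_mul_comm]

/-- A polynomial that agrees with polynomials in the image of `R[X]` modulo every power of `X` lies
in that image. -/
theorem exists_map_eq_of_approx {P : N[X]}
    (h : ∀ L, ∃ a : R[X], ∀ k < L, P.coeff k = (a.map f).coeff k) :
    ∃ a : R[X], P = a.map f := by
  have : P ∈ lifts f := by
    rw [lifts_iff_coeff_lifts]
    intro k
    obtain ⟨a, ha⟩ := h (k + 1)
    exact ⟨a.coeff k, by rw [ha k k.lt_succ_self, coeff_map]⟩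
  obtain ⟨a, ha⟩ := (mem_lifts _).mp this
  exact ⟨a, ha.symm⟩

/-- Expansion sends `X ^ L` to `X ^ (s L)`, still divisible by `X ^ L` as `s > 0`. -/
theorem expand_mul_pow_congr {a a' b b' : R[X]} {L : ℕ} (hs : 0 < s)
    (ha : ∀ k < L, a.coeff k = a'.coeff k) (hb : ∀ k < L, b.coeff k = b'.coeff k) :
    X ^ L ∣ expand R s a * b ^ s - expand R s a' * b' ^ s := by
  have ha' : X ^ L ∣ a - a' := X_pow_dvd_iff.mpr fun d hd => by rw [coeff_sub, ha d hd, sub_self]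
  have hb' : X ^ L ∣ b - b' := X_pow_dvd_iff.mpr fun d hd => by rw [coeff_sub, hb d hd, sub_self]
  apply X_pow_dvd_mul_sub_mul
  · rw [← map_sub]
    refine dvd_trans ?_ (map_dvd (expand R s) ha')
    rw [map_pow, expand_X, ← pow_mul]
    exact pow_dvd_pow _ (Nat.le_mul_of_pos_left L hs)
  · exact hb'.trans (sub_dvd_pow_sub_pow b b' s)

theorem coeff_eq_of_map_eq_polyDet (hf : Function.Injective f) {u v : A[X]} {L : ℕ}
    (huv : ∀ k < L, u.coeff k = v.coeff k) {a α : R[X]} (ha : polyDet ρ₁ u = a.map f)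
    (hα : polyDet ρ₁ v = α.map f) (j : ℕ) (hj : j < L) : a.coeff j = α.coeff j := by
  apply hf
  rw [← coeff_map, ← coeff_map, ← ha, ← hα, polyDet_congr ρ₁ huv hj]

/-- Each coefficient of the determinants, and of the two sides of the congruence, depends on
finitely many coefficients of `u`, so both integrality and the congruence pass to the limit. -/
theorem PowCongruence.of_approx (hf : Function.Injective f) (hs : 0 < s) {u : A[X]}
    (h : ∀ L, ∃ v, PowCongruence f I s ρ₁ ρ₂ σ₁ σ₂ v ∧ ∀ k < L, u.coeff k = v.coeff k) :
    PowCongruence f I s ρ₁ ρ₂ σ₁ σ₂ u := by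
  choose v hv hvu using h
  choose α₁ α₂ β₁ β₂ h1 h2 h3 h4 hα using hv
  obtain ⟨a₁, ha₁⟩ := exists_map_eq_of_approx (f := f) (P := polyDet ρ₁ u) fun L =>
    ⟨α₁ L, fun k hk => by rw [polyDet_congr ρ₁ (hvu L) hk, h1]⟩
  obtain ⟨a₂, ha₂⟩ := exists_map_eq_of_approx (f := f) (P := polyDet ρ₂ u) fun L =>
    ⟨α₂ L, fun k hk => by rw [polyDet_congr ρ₂ (hvu L) hk, h2]⟩
  obtain ⟨b₁, hb₁⟩ := exists_map_eq_of_approx (f := f) (P := polyDet σ₁ u) fun L =>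
    ⟨β₁ L, fun k hk => by rw [polyDet_congr σ₁ (hvu L) hk, h3]⟩
  obtain ⟨b₂, hb₂⟩ := exists_map_eq_of_approx (f := f) (P := polyDet σ₂ u) fun L =>
    ⟨β₂ L, fun k hk => by rw [polyDet_congr σ₂ (hvu L) hk, h4]⟩
  refine ⟨a₁, a₂, b₁, b₂, ha₁, ha₂, hb₁, hb₂, ?_⟩
  ext k
  have e1 := X_pow_dvd_iff.mp (expand_mul_pow_congr hs
    (coeff_eq_of_map_eq_polyDet hf (hvu (k + 1)) ha₁ (h1 _))
    (coeff_eq_of_map_eq_polyDet hf (hvu (k + 1)) hb₂ (h4 _)))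
    k k.lt_succ_self
  have e2 := X_pow_dvd_iff.mp (expand_mul_pow_congr hs
    (coeff_eq_of_map_eq_polyDet hf (hvu (k + 1)) ha₂ (h2 _))
    (coeff_eq_of_map_eq_polyDet hf (hvu (k + 1)) hb₁ (h3 _)))
    k k.lt_succ_self
  rw [coeff_sub, sub_eq_zero] at e1 e2
  have e3 := congrArg (fun P => P.coeff k) (hα (k + 1))
  simp only [coeff_map] at e3 ⊢
  rw [e1, e2, e3]

end FrobeniusCongruence

/-! ### The congruence for representations of a finite group. -/

section Representations

theorem coe_pow_card {N : Type*} [Field N] {G : Type*} [Group G] {u : ℕ} (T : G →* GL (Fin u) N)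
    (g : G) : (T g : Matrix (Fin u) (Fin u) N) ^ Nat.card G = 1 := by
  rw [← Units.val_pow_eq_pow_val, ← map_pow, pow_card_eq_one', map_one, Units.val_one]

variable {R : Type*} [CommRing R] {N : Type*} [Field N] [CharZero N] {A₀ : Type*} [CommRing A₀]
  {G : Type*} [Group G] [Finite G]

/-- The eigenvalues of `T(g)` are roots of unity and so lift to `R`; a single multiset of lifts
serves all powers of `g`. -/
theorem exists_detOneAdd_rep_eq_map {f : R →+* N} {ζ : N} (hζ : IsPrimitiveRoot ζ (Nat.card G))
    (hR : ∀ x : N, x ^ Nat.card G = 1 → x ∈ f.range) {u : ℕ} (T : G →* GL (Fin u) N) (g : G) :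
    ∃ m : Multiset R, ∀ s, 0 < s → detOneAdd (T (g ^ s) : Matrix (Fin u) (Fin u) N) =
      ((m.map fun x => 1 + C (x ^ s) * X).prod).map f := by
  obtain ⟨m, hm, hT⟩ := exists_detOneAdd_pow_eq_prod Nat.card_pos (coe_pow_card T g) hζ
  choose j hj using fun x (hx : x ∈ m) => hR x (hm x hx)
  refine ⟨m.pmap j fun _ => id, fun s hs => ?_⟩
  rw [map_pow, Units.val_pow_eq_pow_val, hT s hs, Polynomial.map_multiset_prod, Multiset.map_map,
    Multiset.map_pmap]
  simp [Multiset.pmap_eq_map, hj]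

variable {p q : ℕ} {f : R →+* N} {I : Ideal R} {i : A₀ →+* R} {F : A₀ →+* A₀}
  {u₁ u₂ v₁ v₂ : ℕ} {S₁ : G →* GL (Fin u₁) N} {S₂ : G →* GL (Fin u₂) N}
  {T₁ : G →* GL (Fin v₁) N} {T₂ : G →* GL (Fin v₂) N}
  {ρ₁ : MonoidAlgebra A₀ G →+* Matrix (Fin u₁) (Fin u₁) N}
  {ρ₂ : MonoidAlgebra A₀ G →+* Matrix (Fin u₂) (Fin u₂) N}
  {σ₁ : MonoidAlgebra A₀ G →+* Matrix (Fin v₁) (Fin v₁) N}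
  {σ₂ : MonoidAlgebra A₀ G →+* Matrix (Fin v₂) (Fin v₂) N}

theorem PowCongruence.one_add_single (hp : p.Prime) (hf : Function.Injective f)
    (hpI : (p : R) ∈ I)
    (hF : ∀ c, i (F c) - i c ^ p ^ q ∈ I) {ζ : N} (hζ : IsPrimitiveRoot ζ (Nat.card G))
    (hR : ∀ x : N, x ^ Nat.card G = 1 → x ∈ f.range)
    (hχ : ∀ g, (S₁ g : Matrix (Fin u₁) (Fin u₁) N).trace +
        (T₂ (g ^ p ^ q) : Matrix (Fin v₂) (Fin v₂) N).trace =
      (S₂ g : Matrix (Fin u₂) (Fin u₂) N).trace +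
        (T₁ (g ^ p ^ q) : Matrix (Fin v₁) (Fin v₁) N).trace)
    (hρ₁ : ∀ g c, ρ₁ (MonoidAlgebra.single g c) = f (i (F c)) • (S₁ g : Matrix _ _ N))
    (hρ₂ : ∀ g c, ρ₂ (MonoidAlgebra.single g c) = f (i (F c)) • (S₂ g : Matrix _ _ N))
    (hσ₁ : ∀ g c, σ₁ (MonoidAlgebra.single g c) = f (i c) • (T₁ g : Matrix _ _ N))
    (hσ₂ : ∀ g c, σ₂ (MonoidAlgebra.single g c) = f (i c) • (T₂ g : Matrix _ _ N))
    (g : G) (c : A₀) (k : ℕ) :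
    PowCongruence f I (p ^ q) ρ₁ ρ₂ σ₁ σ₂ (1 + C (MonoidAlgebra.single g c) * X ^ k) := by
  have hs : 0 < p ^ q := pow_pos hp.pos q
  obtain ⟨m₁, hm₁⟩ := exists_detOneAdd_rep_eq_map hζ hR S₁ g
  obtain ⟨m₂, hm₂⟩ := exists_detOneAdd_rep_eq_map hζ hR S₂ g
  obtain ⟨n₁, hn₁⟩ := exists_detOneAdd_rep_eq_map hζ hR T₁ g
  obtain ⟨n₂, hn₂⟩ := exists_detOneAdd_rep_eq_map hζ hR T₂ g
  have hS₁ := hm₁ 1 one_pos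
  have hS₂ := hm₂ 1 one_pos
  have hT₁ := hn₁ 1 one_pos
  have hT₂ := hn₂ 1 one_pos
  rw [pow_one] at hS₁ hS₂ hT₁ hT₂
  have hcomp : ∀ (P : R[X]) (a : R), (P.map f).comp (C (f a) * X ^ k) =
      (P.comp (C a * X ^ k)).map f := by
    intro P a
    rw [map_comp]
    simp
  refine ⟨_, _, _, _, by rw [polyDet_one_add ρ₁ _ k (hρ₁ g c), hS₁, hcomp],
    by rw [polyDet_one_add ρ₂ _ k (hρ₂ g c), hS₂, hcomp],
    by rw [polyDet_one_add σ₁ _ k (hσ₁ g c), hT₁, hcomp],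
    by rw [polyDet_one_add σ₂ _ k (hσ₂ g c), hT₂, hcomp], ?_⟩
  -- The character identity at every power `g ^ j` says that the block sums of `S₁(g)`, `T₂(g ^ s)`
  -- and of `S₂(g)`, `T₁(g ^ s)` have the same power traces.
  have hprod : (m₁.map fun x => 1 + C (x ^ 1) * X).prod *
        (n₂.map fun x => 1 + C (x ^ p ^ q) * X).prod =
      (m₂.map fun x => 1 + C (x ^ 1) * X).prod *
        (n₁.map fun x => 1 + C (x ^ p ^ q) * X).prod := by
    apply map_injective f hf
    rw [Polynomial.map_mul, Polynomial.map_mul, ← hS₁, ← hS₂, ← hn₁ _ hs, ← hn₂ _ hs,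
      ← detOneAdd_fromBlocks, ← detOneAdd_fromBlocks]
    refine detOneAdd_eq_of_trace_pow_eq fun j => ?_
    rw [trace_fromBlocks_pow, trace_fromBlocks_pow]
    simp only [← Units.val_pow_eq_pow_val, ← map_pow]
    rw [← pow_mul, mul_comm, pow_mul]
    exact hχ (g ^ j)
  -- Once the `s`-th powers are rewritten as expansions, both sides are the image of `hprod` under
  -- the same substitution.
  rw [Polynomial.map_mul, Polynomial.map_mul, ← map_expand_prod_eq_pow hp q hpI (hF c),
    ← map_expand_prod_eq_pow hp q hpI (hF c), ← Polynomial.map_mul, ← Polynomial.map_mul,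
    ← map_mul, ← map_mul, ← mul_comp, ← mul_comp, hprod]

/-- Modulo `I`, the determinant of `F(z)` under `S₁ - S₂ = ψ^s(T₁ - T₂)` is the `s`-th power of the
determinant of `z` under `T₁ - T₂`. -/
theorem exists_det_pow_congruence (hp : p.Prime) (hf : Function.Injective f)
    (hpI : (p : R) ∈ I)
    (hF : ∀ c, i (F c) - i c ^ p ^ q ∈ I) {ζ : N} (hζ : IsPrimitiveRoot ζ (Nat.card G))
    (hR : ∀ x : N, x ^ Nat.card G = 1 → x ∈ f.range)
    (hχ : ∀ g, (S₁ g : Matrix (Fin u₁) (Fin u₁) N).trace +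
        (T₂ (g ^ p ^ q) : Matrix (Fin v₂) (Fin v₂) N).trace =
      (S₂ g : Matrix (Fin u₂) (Fin u₂) N).trace +
        (T₁ (g ^ p ^ q) : Matrix (Fin v₁) (Fin v₁) N).trace)
    (hρ₁ : ∀ g c, ρ₁ (MonoidAlgebra.single g c) = f (i (F c)) • (S₁ g : Matrix _ _ N))
    (hρ₂ : ∀ g c, ρ₂ (MonoidAlgebra.single g c) = f (i (F c)) • (S₂ g : Matrix _ _ N))
    (hσ₁ : ∀ g c, σ₁ (MonoidAlgebra.single g c) = f (i c) • (T₁ g : Matrix _ _ N))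
    (hσ₂ : ∀ g c, σ₂ (MonoidAlgebra.single g c) = f (i c) • (T₂ g : Matrix _ _ N))
    (z : MonoidAlgebra A₀ G) :
    ∃ a₁ a₂ b₁ b₂ : R, (ρ₁ z).det = f a₁ ∧ (ρ₂ z).det = f a₂ ∧ (σ₁ z).det = f b₁ ∧
      (σ₂ z).det = f b₂ ∧ a₁ * b₂ ^ p ^ q - a₂ * b₁ ^ p ^ q ∈ I := by
  -- This polynomial joins `1` at `X = 0`, where the approximation applies, to `z` at `X = 1`.
  have hP : PowCongruence f I (p ^ q) ρ₁ ρ₂ σ₁ σ₂ (1 + C (z - 1) * X) := by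
    refine PowCongruence.of_approx hf (pow_pos hp.pos q) fun L => ?_
    obtain ⟨v, hv, hdvd⟩ := exists_elementary_approx (u := 1 + C (z - 1) * X) (by simp) L
    refine ⟨v, ?_, fun k hk => ?_⟩
    · clear hdvd
      induction hv using Submonoid.closure_induction with
      | mem x hx =>
        obtain ⟨g, c, k, -, rfl⟩ := hx
        exact PowCongruence.one_add_single hp hf hpI hF hζ hR hχ hρ₁ hρ₂ hσ₁ hσ₂ g c k
      | one => exact PowCongruence.one
      | mul x y _ _ hx hy => exact hx.mul hy
    · have := X_pow_dvd_iff.mp hdvd k (by omega)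
      rwa [coeff_sub, sub_eq_zero] at this
  obtain ⟨a₁, a₂, b₁, b₂, h1, h2, h3, h4, h⟩ := hP
  have hz : 1 + (z - 1) = z := by abel
  refine ⟨a₁.eval 1, a₂.eval 1, b₁.eval 1, b₂.eval 1, ?_, ?_, ?_, ?_, ?_⟩
  · rw [← hz, ← eval_one_polyDet, h1, eval_one_map]
  · rw [← hz, ← eval_one_polyDet, h2, eval_one_map]
  · rw [← hz, ← eval_one_polyDet, h3, eval_one_map]
  · rw [← hz, ← eval_one_polyDet, h4, eval_one_map]
  · have e := congrArg (eval 1) h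
    rw [eval_one_map, eval_one_map, Ideal.Quotient.mk_eq_mk_iff_sub_mem] at e
    simpa [expand_eval] using e

end Representations

end GroupRingDet

namespace GroupRingDet

/-! ### Virtual representations as differences. -/

section VirtualReps

variable {N : Type*} [Field N] {G : Type*} [Group G]

theorem RepGroup.exists_of_add_of {a b : ℕ} (S : G →* GL (Fin a) N) (T : G →* GL (Fin b) N) :
    ∃ U : G →* GL (Fin (a + b)) N, RepGroup.of S + RepGroup.of T = RepGroup.of U := by
  let ρ : G →* Matrix (Fin (a + b)) (Fin (a + b)) N :=
    { toFun := fun g => Matrix.reindex finSumFinEquiv finSumFinEquiv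
        (Matrix.fromBlocks (S g : Matrix (Fin a) (Fin a) N) 0 0
          (T g : Matrix (Fin b) (Fin b) N))
      map_one' := by simp
      map_mul' := fun g h => by
        simp [Matrix.submatrix_mul_equiv, Matrix.fromBlocks_multiply] }
  refine ⟨MonoidHom.toHomUnits ρ, ?_⟩
  symm
  rw [← sub_eq_zero]
  exact (QuotientAddGroup.eq_zero_iff _).mpr (AddSubgroup.subset_closure
    (Or.inr ⟨a, b, S, T, MonoidHom.toHomUnits ρ, fun g => rfl, rfl⟩))

theorem RepGroup.exists_eq_of_sub_of (T : RepGroup N G) :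
    ∃ (a b : ℕ) (S₁ : G →* GL (Fin a) N) (S₂ : G →* GL (Fin b) N),
      T = RepGroup.of S₁ - RepGroup.of S₂ := by
  -- The degree-zero representation is its own direct sum with itself, so its class is idempotent
  -- for addition.
  have hzero : (RepGroup.of (1 : G →* GL (Fin 0) N)) = 0 := by
    obtain ⟨U, hU⟩ := RepGroup.exists_of_add_of (1 : G →* GL (Fin 0) N) (1 : G →* GL (Fin 0) N)
    have : U = 1 := by
      ext g i
      exact i.elim0
    rw [this] at hU
    exact add_eq_left.mp hU
  induction T using QuotientAddGroup.induction_on with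
  | H T =>
  induction T using FreeAbelianGroup.induction_on with
  | zero => exact ⟨0, 0, 1, 1, by rw [sub_self]; rfl⟩
  | of T => exact ⟨T.1, 0, T.2, 1, by rw [hzero, sub_zero]; rfl⟩
  | neg T h =>
    obtain ⟨a, b, S₁, S₂, h⟩ := h
    exact ⟨b, a, S₂, S₁, by rw [QuotientAddGroup.mk_neg, h, neg_sub]⟩
  | add T T' h h' =>
    obtain ⟨a, b, S₁, S₂, h⟩ := h
    obtain ⟨a', b', S₁', S₂', h'⟩ := h'
    obtain ⟨U₁, hU₁⟩ := RepGroup.exists_of_add_of S₁ S₁'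
    obtain ⟨U₂, hU₂⟩ := RepGroup.exists_of_add_of S₂ S₂'
    refine ⟨a + a', b + b', U₁, U₂, ?_⟩
    rw [QuotientAddGroup.mk_add, h, h', ← hU₁, ← hU₂]
    abel

end VirtualReps

/-! ### Valuation rings and the residue characteristic. -/

section LocalFields

variable {p : ℕ} [Fact p.Prime] {K M N : Type*} [Field K] [Field M] [Field N] [Algebra ℚ_[p] K]
  [Algebra ℚ_[p] M] [Algebra ℚ_[p] N] [Algebra K M] [Algebra M N] [IsScalarTower ℚ_[p] K M]
  [IsScalarTower ℚ_[p] M N]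

variable (p M N) in
/-- The inclusion of valuation rings attached to an extension `N / M`. -/
noncomputable def valRingInclusion : valRing p M →+* valRing p N :=
  (algebraMap M N).restrict (valRing p M) (valRing p N) fun _ hx =>
    IsIntegral.map ((IsScalarTower.toAlgHom ℚ_[p] M N).restrictScalars (PadicInt.subring p)) hx

theorem mem_valRing_of_pow_eq_one {n : ℕ} (hn : 0 < n) {x : N} (hx : x ^ n = 1) :
    x ∈ valRing p N :=
  IsIntegral.of_pow (R := PadicInt.subring p) hn (by rw [hx]; exact isIntegral_one)

/-- Since `F` fixes `p`, the Frobenius congruence at `p` puts `p - p ^ s = (1 - p ^ (s - 1)) p` in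
the ideal, and the first factor is already a unit of `ℤ_p`. -/
theorem natCast_mem_of_isFrobeniusLift {π : valRing p M} {s : ℕ} (hs : 1 < s) {F : M ≃ₐ[K] M}
    (hF : IsFrobeniusLift π s F) : (p : valRing p M) ∈ Ideal.span {π} := by
  have h := hF p
  rw [map_natCast] at h
  obtain ⟨t, rfl⟩ : ∃ t, s = t + 1 + 1 := ⟨s - 2, by omega⟩
  have hunit : IsUnit ((1 : ℤ_[p]) - (p : ℤ_[p]) ^ (t + 1)) := by
    apply IsLocalRing.isUnit_one_sub_self_of_mem_nonunits
    rw [mem_nonunits_iff, isUnit_pow_succ_iff]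
    exact PadicInt.prime_p.not_isUnit
  let ι : PadicInt.subring p →+* valRing p M :=
    algebraMap (PadicInt.subring p) (integralClosure (PadicInt.subring p) M)
  have hunit' := IsUnit.map ι (show IsUnit ((1 : PadicInt.subring p) - p ^ (t + 1)) from hunit)
  rw [map_sub, map_one, map_pow, map_natCast] at hunit'
  rw [pow_succ, ← one_sub_mul] at h
  exact (Ideal.unit_mul_mem_iff_mem _ hunit').mp h

end LocalFields

section DetLemmas

variable {p : ℕ} [Fact p.Prime] {M N : Type*} [Field M] [Field N] [Algebra ℚ_[p] M]
  [Algebra M N] {G : Type*} [Group G]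

theorem Det_sub (z : (MonoidAlgebra (valRing p M) G)ˣ) (S T : RepGroup N G) :
    Det z (S - T) = Det z S / Det z T := by
  rw [Det, map_sub]
  rfl

end DetLemmas

end GroupRingDet

/-! ### The quotient of determinants. -/

theorem theorem2p1 {p q : ℕ} [Fact p.Prime]
    {K M N : Type*} [Field K] [Field M] [Field N]
    [Algebra ℚ_[p] K] [Algebra ℚ_[p] M] [Algebra ℚ_[p] N] [Algebra K M] [Algebra M N]
    [IsScalarTower ℚ_[p] K M] [IsScalarTower ℚ_[p] M N]
    [FiniteDimensional ℚ_[p] N] [IsGalois ℚ_[p] N] [IsGalois K M]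
    {G : Type*} [Group G] [Finite G]
    (hroots : ∃ ζ : N, IsPrimitiveRoot ζ (Nat.card G))
    (πK : valRing p K) (hπK : IsUniformizer p K πK)
    (hq : Nat.card (valRing p K ⧸ Ideal.span {πK}) = p ^ q)
    (πM : valRing p M) (hπM : IsUniformizer p M πM)
    (F : M ≃ₐ[K] M) (hF : IsFrobeniusLift πM (p ^ q) F)
    (z : (MonoidAlgebra (valRing p M) G)ˣ) (T : RepGroup N G) :
    ∃ y ∈ valRing p N,
      ((Det (frobUnits F z) (adams (p ^ q) T) / Det z T ^ (p ^ q) : Nˣ) : N) =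
        1 + algebraMap M N (πM : M) * y := by
  obtain ⟨ζ, hζ⟩ := hroots
  have hp : p.Prime := Fact.out
  have : CharZero N := charZero_of_injective_algebraMap (algebraMap ℚ_[p] N).injective
  -- If `q` were `0`, the residue ring of `K` would have one element, against the maximality of the
  -- ideal of `πK`.
  have hs : 1 < p ^ q := by
    apply one_lt_pow₀ hp.one_lt
    rintro rfl
    rw [pow_zero, Nat.card_eq_one_iff_unique] at hq
    have := hq.1
    exact hπK.ne_top (Ideal.Quotient.subsingleton_iff.mp this)
  set i := valRingInclusion p M N with hi
  set I : Ideal (valRing p N) := Ideal.span {i πM} with hI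
  have hmem : ∀ x ∈ Ideal.span {πM}, i x ∈ I := fun x hx => by
    rw [hI, ← Set.image_singleton, ← Ideal.map_span]
    exact Ideal.mem_map_of_mem i hx
  have hpI : (p : valRing p N) ∈ I := by
    have := hmem _ (natCast_mem_of_isFrobeniusLift hs hF)
    rwa [map_natCast] at this
  have hFI : ∀ c : valRing p M, i (valRingMap F c) - i c ^ p ^ q ∈ I := fun c => by
    rw [← map_pow, ← map_sub]
    exact hmem _ (hF c)
  have hR : ∀ x : N, x ^ Nat.card G = 1 → x ∈ (valRing p N).subtype.range := fun x hx =>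
    ⟨⟨x, mem_valRing_of_pow_eq_one Nat.card_pos hx⟩, rfl⟩
  obtain ⟨v₁, v₂, T₁, T₂, hT⟩ := RepGroup.exists_eq_of_sub_of T
  obtain ⟨u₁, u₂, S₁, S₂, hS⟩ := RepGroup.exists_eq_of_sub_of (adams (p ^ q) T)
  have hχ : ∀ g, (S₁ g : Matrix (Fin u₁) (Fin u₁) N).trace +
        (T₂ (g ^ p ^ q) : Matrix (Fin v₂) (Fin v₂) N).trace =
      (S₂ g : Matrix (Fin u₂) (Fin u₂) N).trace +
        (T₁ (g ^ p ^ q) : Matrix (Fin v₁) (Fin v₁) N).trace := by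
    intro g
    have h := character_adams (p ^ q) T g
    rw [hS, hT, map_sub, map_sub, Pi.sub_apply, Pi.sub_apply, RepGroup.character_of,
      RepGroup.character_of, RepGroup.character_of, RepGroup.character_of] at h
    linear_combination h
  set Φ := MonoidAlgebra.mapRingHom G (valRingMap (p := p) F) with hΦ
  have hsingle : ∀ {u : ℕ} (S : G →* GL (Fin u) N) (g : G) (c : valRing p M),
      ((evalRep S : MonoidAlgebra (valRing p M) G →ₐ[valRing p M] _).toRingHom.comp Φ)
        (MonoidAlgebra.single g c) =
        (valRing p N).subtype (i (valRingMap F c)) • (S g : Matrix (Fin u) (Fin u) N) := by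
    intro u S g c
    rw [RingHom.comp_apply, hΦ, MonoidAlgebra.mapRingHom_single]
    exact evalRep_single S g _
  have core := exists_det_pow_congruence hp (valRing p N).subtype_injective hpI hFI hζ hR hχ
    (hsingle S₁) (hsingle S₂)
    (σ₁ := (evalRep T₁ : MonoidAlgebra (valRing p M) G →ₐ[valRing p M] _).toRingHom)
    (σ₂ := (evalRep T₂ : MonoidAlgebra (valRing p M) G →ₐ[valRing p M] _).toRingHom)
    (evalRep_single T₁) (evalRep_single T₂)
  obtain ⟨a₁, a₂, b₁, b₂, ha₁, ha₂, hb₁, hb₂, hab⟩ := core z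
  -- Only integrality is used for `z⁻¹`: it provides inverses in `O_N` of `a₂` and `b₁`.
  obtain ⟨-, a₂', b₁', -, -, ha₂', hb₁', -, -⟩ := core ↑z⁻¹
  have hunits : ∀ {u : ℕ} (ρ : MonoidAlgebra (valRing p M) G →+* Matrix (Fin u) (Fin u) N),
      (ρ ↑z).det * (ρ ↑z⁻¹).det = 1 := fun ρ => by
    rw [← Matrix.det_mul, ← map_mul, Units.mul_inv, map_one, Matrix.det_one]
  have ha : (a₂ : N) * (a₂' : N) = 1 := by
    have h := hunits
      ((evalRep S₂ : MonoidAlgebra (valRing p M) G →ₐ[valRing p M] _).toRingHom.comp Φ)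
    rwa [ha₂, ha₂'] at h
  have hb : (b₁ : N) * (b₁' : N) = 1 := by
    have h := hunits (evalRep T₁ : MonoidAlgebra (valRing p M) G →ₐ[valRing p M] _).toRingHom
    rwa [hb₁, hb₁'] at h
  obtain ⟨r, hr⟩ := Ideal.mem_span_singleton'.mp hab
  have hr' : (r : N) * algebraMap M N (πM : M) = a₁ * b₂ ^ p ^ q - a₂ * b₁ ^ p ^ q :=
    congrArg Subtype.val hr
  have hD₁ : (Det (frobUnits F z) (RepGroup.of S₁) : N) = a₁ := (Det_of _ _).trans ha₁
  have hD₂ : (Det (frobUnits F z) (RepGroup.of S₂) : N) = a₂ := (Det_of _ _).trans ha₂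
  have hE₁ : (Det z (RepGroup.of T₁) : N) = b₁ := (Det_of _ _).trans hb₁
  have hE₂ : (Det z (RepGroup.of T₂) : N) = b₂ := (Det_of _ _).trans hb₂
  -- The quotient equals `a₁ b₂ ^ s / (a₂ b₁ ^ s)`, that is `1 + r π_M / (a₂ b₁ ^ s)`.
  refine ⟨_, (r * a₂' * b₁' ^ p ^ q).2, ?_⟩
  have ha₂0 : (a₂ : N) ≠ 0 := left_ne_zero_of_mul_eq_one ha
  have hb₁0 : (b₁ : N) ≠ 0 := left_ne_zero_of_mul_eq_one hb
  rw [hS, hT, Det_sub, Det_sub, Units.val_div_eq_div_val, Units.val_pow_eq_pow_val,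
    Units.val_div_eq_div_val, Units.val_div_eq_div_val, hD₁, hD₂, hE₁, hE₂]
  push_cast
  rw [eq_inv_of_mul_eq_one_right ha, eq_inv_of_mul_eq_one_right hb, div_pow, div_div_div_eq,
    eq_add_of_sub_eq hr'.symm, inv_pow, add_div, div_self (mul_ne_zero ha₂0 (pow_ne_zero _ hb₁0)),
    div_eq_mul_inv, mul_inv]
  ring
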